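/- **Setting.** For a full-rank lattice $\Lambda\subset\mathbb R^n$ let $Q_\Lambda$ be a nearest-point quantizer (Euclidean distance, ties broken by any fixed measurable rule), $[x]\bmod\Lambda:=x-Q_\Lambda(x)$, $\mathcal V(\Lambda):=\{x:Q_\Lambda(x)=0\}$, $\mathrm{vol}(\Lambda):=\mathrm{vol}(\mathcal V(\Lambda))$, and $\sigma^2(\Lambda):=\frac{1}{n\,\mathrm{vol}(\Lambda)}\int_{\mathcal V(\Lambda)}\|x\|^2dx$. Let $r_{\mathrm{cov}}(\Lambda)$ be the radius of the smallest closed ball centred at $0$ containing $\mathcal V(\Lambda)$, and $r_{\mathrm{eff}}(\Lambda)$ the radius of a ball of volume $\mathrm{vol}(\Lambda)$. A sequence of lattices, indexed by the dimension $n$, is *good for covering* if $r_{\mathrm{cov}}/r_{\mathrm{eff}}\to1$. It is *good for AWGN channel coding* if for every $\mu\ge 2\pi e$, with $Z$ an $n$-dimensional white Gaussian vector of mean zero and variance $\mathrm{vol}(\Lambda)^{2/n}/\mu$ per coordinate, $\Pr[Z\notin\mathcal V(\Lambda)]\le e^{-n(E_U(\mu)-o_n(1))}$, where $E_U$ is the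 Poltyrev exponent: $E_U(\mu)=\frac{\mu}{4\pi e}-\frac12\ln\frac{\mu}{2\pi}$ for $2\pi e\le\mu\le4\pi e$, $\frac12\ln\frac{\mu}{8\pi}$ for $4\pi e\le\mu\le8\pi e$, and $\frac{\mu}{16\pi e}$ for $\mu\ge8\pi e$. Let $T$ be a finite tree with vertex set $V$ (the terminals), and let $(X_v)_{v\in V}$ be jointly Gaussian with zero means and unit variances, forming a Markov chain on $T$ (if every path from $I$ to $J$ passes through $v$, where $I,J\subset V$ are disjoint, then $(X_i)_{i\in I}$ and $(X_j)_{j\in J}$ are conditionally independent given $X_v$); put $\rho_{uv}=\mathbb E[X_uX_v]$. Terminal $v$ observes the $v$-components of i.i.d. copies of this vector, cut into consecutive blocks $x_v^{(i)}\in\mathbb R^n$ of $n$ samples. For every $n$, each terminal $v$ has nested $n$-dimensional lattices $\Lambda_v^{(2)}\subset\Lambda_v^{(1)}\subset\Lambda_v$ such that, as sequences in $n$, $\Lambda_v$ is good for covering and $\Lambda_v^{(1)},\Lambda_v^{(2)}$ are good for AWGN channel coding. The dithers $d_v^{(i)}$ are uniform over $\mathcal V(\Lambda_v)$, independent of each other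 and of the source. Let $$y_v^{(i)}=\big[Q_{\Lambda_v}(x_v^{(i)}+d_v^{(i)})-d_v^{(i)}\big]\bmod\Lambda_v^{(2)},\qquad w_v^{(i)}=[y_v^{(i)}]\bmod\Lambda_v^{(1)},$$ and, for a vertex $v$ and a neighbour $u$ of $v$ in $T$, $$\hat y_v^{(i)}=w_v^{(i)}+Q_{\Lambda_v^{(1)}}\big(\rho_{uv}y_u^{(i)}-w_v^{(i)}\big).$$ **Proposition 1.** There is a function $E$ with $E(\delta)>0$ for every $\delta>0$ such that the following holds in every such setting (so one may take $E_{uv}=E$). Let $v\in V$, let $u$ be a neighbour of $v$ in $T$, and let $\delta>0$. Then there is $n_0$ such that for all $n\ge n_0$ for which $$\frac{\mathrm{vol}(\Lambda_v^{(1)})^{2/n}}{2\pi e}>(1+\delta)\max_{u'\in N_T(v)}\big(1-\rho_{u'v}^2+\sigma^2(\Lambda_v)+\rho_{u'v}^2\sigma^2(\Lambda_{u'})\big),$$ $$\frac{\mathrm{vol}(\Lambda_v^{(2)})^{2/n}}{2\pi e}>(1+\sigma^2(\Lambda_v))(1+\delta)\quad\text{and}\quad\frac{\mathrm{vol}(\Lambda_u^{(2)})^{2/n}}{2\pi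 e}>(1+\sigma^2(\Lambda_u))(1+\delta),$$ where $N_T(v)$ is the set of neighbours of $v$ in $T$, every block $i$ satisfies $$\Pr\big[\hat y_v^{(i)}\ne y_v^{(i)}\big]\le e^{-nE(\delta)}.$$ -/

import Mathlib

open MeasureTheory ProbabilityTheory Filter Topology

namespace LatticeKey

noncomputable section

/-! ### Lattices in Euclidean space and their quantizers -/

/-- A full-rank lattice in `ℝⁿ`, together with a (measurable) nearest-point quantizer.
The map `Q` encodes the fixed rule by which ties are resolved; any rule is allowed. -/
structure EucLattice (n : ℕ) where
  /-- the set of lattice points -/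
  pts : Submodule ℤ (EuclideanSpace ℝ (Fin n))
  /-- the lattice is discrete -/
  discrete : DiscreteTopology pts
  /-- the lattice has full rank -/
  fullRank : IsZLattice ℝ pts
  /-- the quantizer -/
  Q : EuclideanSpace ℝ (Fin n) → EuclideanSpace ℝ (Fin n)
  measurable_Q : Measurable Q
  Q_mem : ∀ x, Q x ∈ pts
  Q_nearest : ∀ x, ∀ y ∈ pts, ‖x - Q x‖ ≤ ‖x - y‖

namespace EucLattice

variable {n : ℕ}

/-- `[x] mod Λ := x - Q_Λ(x)`. -/
def mod (L : EucLattice n) (x : EuclideanSpace ℝ (Fin n)) : EuclideanSpace ℝ (Fin n) := x - L.Q x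

/-- The fundamental Voronoi region `𝒱(Λ) = {x : Q_Λ(x) = 0}`. -/
def voronoi (L : EucLattice n) : Set (EuclideanSpace ℝ (Fin n)) := {x | L.Q x = 0}

/-- `vol(Λ)`, the volume of the fundamental Voronoi region. -/
def vol (L : EucLattice n) : ℝ := volume.real L.voronoi

/-- The second moment per dimension, `σ²(Λ) = (1 / (n vol(Λ))) ∫_{𝒱(Λ)} ‖x‖² dx`. -/
def sigmaSq (L : EucLattice n) : ℝ := (1 / (n * L.vol)) * ∫ x in L.voronoi, ‖x‖ ^ 2

/-- The covering radius: the radius of the smallest closed ball centred at `0` that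
contains the fundamental Voronoi region. -/
def rCov (L : EucLattice n) : ℝ :=
  sInf {r : ℝ | 0 ≤ r ∧ L.voronoi ⊆ Metric.closedBall 0 r}

/-- The effective radius: the radius of a ball in `ℝⁿ` whose volume is `vol(Λ)`, that is, the
solution `r` of `rⁿ vol(B(0,1)) = vol(Λ)` (for `n ≥ 1`). -/
def rEff (L : EucLattice n) : ℝ :=
  (L.vol / volume.real (Metric.ball (0 : EuclideanSpace ℝ (Fin n)) 1)) ^ (1 / (n : ℝ))

end EucLattice

/-! ### Goodness of sequences of lattices indexed by the dimension -/

/-- A sequence of lattices is good for covering if `r_cov / r_eff → 1`. -/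
def GoodForCovering (L : ∀ n : ℕ, EucLattice n) : Prop :=
  Tendsto (fun n => (L n).rCov / (L n).rEff) atTop (𝓝 1)

/-- The Poltyrev exponent `E_U(μ)`; it is only used for `μ ≥ 2πe`. -/
def poltyrevExponent (μ : ℝ) : ℝ :=
  if 8 * Real.pi * Real.exp 1 ≤ μ then μ / (16 * Real.pi * Real.exp 1)
  else if 4 * Real.pi * Real.exp 1 ≤ μ then 1 / 2 * Real.log (μ / (8 * Real.pi))
  else μ / (4 * Real.pi * Real.exp 1) - 1 / 2 * Real.log (μ / (2 * Real.pi))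

/-- The law of an `n`-dimensional white Gaussian vector with mean zero and variance `s` per
dimension. -/
def whiteGaussian (n : ℕ) (s : ℝ) : Measure (EuclideanSpace ℝ (Fin n)) :=
  (stdGaussian (EuclideanSpace ℝ (Fin n))).map (fun z => Real.sqrt s • z)

/-- A sequence of lattices is good for AWGN channel coding: for every volume-to-noise ratio
`μ ≥ 2πe`, if the noise variance per dimension is `vol(Λ)^{2/n} / μ`, then
`Pr[Z ∉ 𝒱(Λ)] ≤ exp(-n (E_U(μ) - o_n(1)))`. -/
def GoodForAWGN (L : ∀ n : ℕ, EucLattice n) : Prop :=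
  ∀ μ : ℝ, 2 * Real.pi * Real.exp 1 ≤ μ →
    ∃ o : ℕ → ℝ, Tendsto o atTop (𝓝 0) ∧
      ∀ n : ℕ,
        (whiteGaussian n ((L n).vol ^ (2 / (n : ℝ)) / μ)).real ((L n).voronoi)ᶜ
          ≤ Real.exp (-(n * (poltyrevExponent μ - o n)))

/-! ### The source -/

/-- `ν` is the joint law of a Gaussian Markov tree source `(X_v)_{v ∈ V}` on the tree `T`, with
zero means and unit variances. The Markov property: whenever every path from `I` to `J` passes
through `v`, the families `X_I` and `X_J` are conditionally independent given `X_v`. -/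
structure IsGaussianMarkovTree {V : Type*} [Fintype V] (T : SimpleGraph V)
    (ν : Measure (V → ℝ)) : Prop where
  isTree : T.IsTree
  isGaussian : IsGaussian ν
  mean_zero : ∀ v, ∫ x, x v ∂ν = 0
  unit_variance : ∀ v, ∫ x, x v ^ 2 ∂ν = 1
  markov : ∀ (I J : Set V) (v : V), Disjoint I J →
    (∀ i ∈ I, ∀ j ∈ J, ∀ p : T.Walk i j, v ∈ p.support) →
    CondIndepFun (MeasurableSpace.comap (fun x : V → ℝ => x v) inferInstance)
      (measurable_pi_apply v).comap_le
      (fun (x : V → ℝ) (i : I) => x i) (fun (x : V → ℝ) (j : J) => x j) ν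

/-- The correlation `ρ_{uv} = 𝔼[X_u X_v]`. -/
def corr {V : Type*} (ν : Measure (V → ℝ)) (u v : V) : ℝ := ∫ x, x u * x v ∂ν

/-- The randomness available to the terminals. `X v t` is the `t`-th sample at terminal `v`; the
vectors `(X v t)_v` are i.i.d. over `t` with law `ν`. In dimension `n`, `d n v i` is the dither of
terminal `v` for block `i`, uniform over the Voronoi region of `Λ_v = L n v`; the dithers are
independent of each other and of the source. -/
structure IsSourceWithDithers {V : Type*} {Ω : Type*} [MeasurableSpace Ω]
    (P : Measure Ω) (ν : Measure (V → ℝ)) (L : ∀ n : ℕ, V → EucLattice n)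
    (X : V → ℕ → Ω → ℝ) (d : ∀ n : ℕ, V → ℕ → Ω → EuclideanSpace ℝ (Fin n)) : Prop where
  source_law : ∀ t, HasLaw (fun ω v => X v t ω) ν P
  source_indep : iIndepFun (fun t ω v => X v t ω) P
  dither_law : ∀ n v i, HasLaw (d n v i) (cond volume (L n v).voronoi) P
  dither_indep : ∀ n, iIndepFun (fun (vi : V × ℕ) => d n vi.1 vi.2) P
  indep : ∀ n, IndepFun (fun ω (vt : V × ℕ) => X vt.1 vt.2 ω)
    (fun ω (vi : V × ℕ) => d n vi.1 vi.2 ω) P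

/-! ### The protocol -/

/-- The `i`-th block of `n` consecutive samples (blocks are numbered from `0`). -/
def block {Ω : Type*} (x : ℕ → Ω → ℝ) (n i : ℕ) (ω : Ω) : EuclideanSpace ℝ (Fin n) :=
  WithLp.toLp 2 (fun j : Fin n => x (i * n + j) ω)

/-- Quantizer output `y = [Q_Λ(x + d) - d] mod Λ⁽²⁾`. -/
def quantized {n : ℕ} (L L2 : EucLattice n) (x d : EuclideanSpace ℝ (Fin n)) :
    EuclideanSpace ℝ (Fin n) :=
  L2.mod (L.Q (x + d) - d)

/-- The estimate `ŷ_v = w_v + Q_{Λ_v⁽¹⁾}(ρ y_u - w_v)` computed from `y_u` and the broadcast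
`w_v`. -/
def estimate {n : ℕ} (L1 : EucLattice n) (ρ : ℝ) (yu wv : EuclideanSpace ℝ (Fin n)) :
    EuclideanSpace ℝ (Fin n) :=
  wv + L1.Q (ρ • yu - wv)

end

end LatticeKey

open LatticeKey

open LatticeKey

/-! Let ỹ = Q_Λ(x + d) − d be a quantizer output before reduction (`dithered`). If ỹ_u and ỹ_v lie
strictly inside the Voronoi regions of Λ_u⁽²⁾ and Λ_v⁽²⁾, reduction changes neither. If also ρỹ_u −
ỹ_v lies strictly inside that of Λ_v⁽¹⁾, then ρy_u − w_v is the lattice point Q(y_v) plus a vector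
that rounds to 0, and decoding is exact (`estimate_eq`). The error event is thus covered by three
events of the form "aỹ_u + bỹ_v leaves a Voronoi region", with (a, b) = (1, 0), (0, 1), (ρ, −1).

By the crypto lemma, ỹ − x is distributed as −d whatever x is, so aỹ_u + bỹ_v is a white Gaussian
vector plus independent scaled dithers (`IsSourceWithDithers.hasLaw_dithered`). Goodness for
covering bounds the uniform law on 𝒱(Λ) by e^{nη} times a white Gaussian law of variance at most (1
+ η)σ²(Λ) (`GoodForCovering.eventually_dominated`). Up to a factor e^{2nη} the total noise is
therefore white Gaussian, with variance at most 1 + η times the one in the matching volume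
condition. Goodness for AWGN coding at a fixed μ slightly above 2πe, where E_U is positive, bounds
each event (`GoodForAWGN.eventually_le`). Choosing η small against both δ and E_U(μ) leaves a
positive exponent that depends on δ alone. -/

namespace LatticeKey

/-! ### White Gaussian vectors -/

section WhiteGaussian

variable {n : ℕ}

instance (s : ℝ) : IsProbabilityMeasure (whiteGaussian n s) :=
  Measure.isProbabilityMeasure_map (Measurable.aemeasurable (by fun_prop))

/-- Identities between white Gaussian laws are reduced to this formula. The case s = 0 is kept
because ρX_u − X_v degenerates when |ρ| = 1. -/
lemma charFun_whiteGaussian {s : ℝ} (hs : 0 ≤ s) (t : EuclideanSpace ℝ (Fin n)) :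
    charFun (whiteGaussian n s) t = Complex.exp (-(s * ‖t‖ ^ 2) / 2) := by
  rw [whiteGaussian, charFun_map_smul, charFun_stdGaussian]
  congr 1
  rw [norm_smul, Real.norm_of_nonneg (Real.sqrt_nonneg _)]
  push_cast
  rw [mul_pow, ← Complex.ofReal_pow, Real.sq_sqrt hs]

lemma whiteGaussian_conv {s t : ℝ} (hs : 0 ≤ s) (ht : 0 ≤ t) :
    (whiteGaussian n s).conv (whiteGaussian n t) = whiteGaussian n (s + t) := by
  apply Measure.ext_of_charFun
  ext x
  rw [charFun_conv, charFun_whiteGaussian hs, charFun_whiteGaussian ht,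
    charFun_whiteGaussian (add_nonneg hs ht), ← Complex.exp_add]
  congr 1
  push_cast
  ring

lemma map_smul_whiteGaussian {s : ℝ} (hs : 0 ≤ s) (c : ℝ) :
    (whiteGaussian n s).map (fun x => c • x) = whiteGaussian n (c ^ 2 * s) := by
  apply Measure.ext_of_charFun
  ext x
  rw [charFun_map_smul, charFun_whiteGaussian hs, charFun_whiteGaussian (by positivity)]
  congr 1
  rw [norm_smul]
  push_cast
  rw [mul_pow, ← Complex.ofReal_pow, Real.norm_eq_abs, sq_abs]
  push_cast
  ring

lemma map_toLp_pi_gaussianReal (s : NNReal) :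
    (Measure.pi fun _ : Fin n => gaussianReal 0 s).map (WithLp.toLp 2) = whiteGaussian n s := by
  apply Measure.ext_of_charFun (E := EuclideanSpace ℝ (Fin n))
  ext t
  simp_rw [charFun_whiteGaussian s.coe_nonneg, charFun_pi, charFun_gaussianReal, ← Complex.exp_sum,
    ← Complex.ofReal_pow, EuclideanSpace.real_norm_sq_eq]
  simp [Finset.mul_sum, Finset.sum_div, neg_div]

/-- The density of a white Gaussian vector. -/
lemma whiteGaussian_eq_withDensity {s : ℝ} (hs : 0 < s) :
    whiteGaussian n s = volume.withDensity fun x : EuclideanSpace ℝ (Fin n) =>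
      ENNReal.ofReal ((2 * Real.pi * s) ^ (-(n / 2 : ℝ)) * Real.exp (-‖x‖ ^ 2 / (2 * s))) := by
  have hint : Integrable (fun x : EuclideanSpace ℝ (Fin n) =>
      (2 * Real.pi * s) ^ (-(n / 2 : ℝ)) * Real.exp (-‖x‖ ^ 2 / (2 * s))) := by
    refine Integrable.const_mul ?_ _
    have := (GaussianFourier.integrable_cexp_neg_mul_sq_norm_add (b := (1 / (2 * s) : ℝ))
      (by simpa using hs) 0 (0 : EuclideanSpace ℝ (Fin n))).re
    refine this.congr (ae_of_all _ fun x => ?_)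
    have : (-((1 / (2 * s) : ℝ) : ℂ) * (‖x‖ : ℂ) ^ 2 + 0 * ((inner ℝ 0 x : ℝ) : ℂ))
        = ((-‖x‖ ^ 2 / (2 * s) : ℝ) : ℂ) := by push_cast; ring
    simp only [this]
    rw [← Complex.ofReal_exp]
    exact Complex.ofReal_re _
  have hfin : IsFiniteMeasure (volume.withDensity fun x : EuclideanSpace ℝ (Fin n) =>
      ENNReal.ofReal ((2 * Real.pi * s) ^ (-(n / 2 : ℝ)) * Real.exp (-‖x‖ ^ 2 / (2 * s)))) :=
    isFiniteMeasure_withDensity_ofReal hint.2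
  apply Measure.ext_of_charFun
  ext t
  rw [charFun_whiteGaussian hs.le, charFun_apply, integral_withDensity_eq_integral_toReal_smul
    (by fun_prop) (ae_of_all _ fun _ => ENNReal.ofReal_lt_top)]
  have key := GaussianFourier.integral_cexp_neg_mul_sq_norm_add (b := (1 / (2 * s) : ℝ))
    (by simpa using hs) Complex.I t
  have : ∀ x : EuclideanSpace ℝ (Fin n), (ENNReal.ofReal ((2 * Real.pi * s) ^ (-(n / 2 : ℝ)) *
        Real.exp (-‖x‖ ^ 2 / (2 * s)))).toReal • Complex.exp (inner ℝ x t * Complex.I)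
      = (((2 * Real.pi * s) ^ (-(n / 2 : ℝ)) : ℝ) : ℂ) *
        Complex.exp (-((1 / (2 * s) : ℝ) : ℂ) * (‖x‖ : ℂ) ^ 2
          + Complex.I * ((inner ℝ t x : ℝ) : ℂ)) := fun x => by
    rw [ENNReal.toReal_ofReal (by positivity), Complex.real_smul, Complex.exp_add,
      real_inner_comm, mul_comm Complex.I]
    push_cast
    rw [mul_assoc]
    congr 3
    ring
  simp_rw [this]
  rw [integral_const_mul, key, ← mul_assoc]
  have h1 : ((Real.pi : ℂ) / ((1 / (2 * s) : ℝ) : ℂ)) = ((2 * Real.pi * s : ℝ) : ℂ) := by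
    push_cast
    field_simp
  rw [h1, finrank_euclideanSpace, Fintype.card_fin]
  have h2 : (((2 * Real.pi * s : ℝ) : ℂ)) ^ ((n : ℂ) / 2)
      = (((2 * Real.pi * s) ^ (n / 2 : ℝ) : ℝ) : ℂ) := by
    rw [Complex.ofReal_cpow (by positivity)]
    push_cast
    rfl
  rw [h2, ← Complex.ofReal_mul, ← Real.rpow_add (by positivity)]
  simp only [neg_add_cancel, Real.rpow_zero, Complex.ofReal_one, one_mul]
  congr 1
  rw [Complex.I_sq]
  have : (s : ℂ) ≠ 0 := by exact_mod_cast hs.ne'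
  push_cast
  field_simp
  ring

lemma whiteGaussian_absolutelyContinuous {s : ℝ} (hs : 0 < s) :
    whiteGaussian n s ≪ (volume : Measure (EuclideanSpace ℝ (Fin n))) := by
  rw [whiteGaussian_eq_withDensity hs]
  exact withDensity_absolutelyContinuous _ _

/-- The probability of leaving a set that is star-shaped around the origin increases with the
variance of the noise. -/
lemma whiteGaussian_compl_mono {s t : ℝ} (hs : 0 ≤ s) (hst : s ≤ t)
    {A : Set (EuclideanSpace ℝ (Fin n))} (hA : MeasurableSet A)
    (hstar : ∀ x ∈ A, ∀ c : ℝ, 0 ≤ c → c ≤ 1 → c • x ∈ A) :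
    whiteGaussian n s Aᶜ ≤ whiteGaussian n t Aᶜ := by
  rcases hst.eq_or_lt with rfl | hlt
  · rfl
  have ht : 0 < t := hs.trans_lt hlt
  have hc : Real.sqrt (s / t) ≤ 1 :=
    Real.sqrt_le_one.2 ((div_le_one ht).2 hst)
  -- The smaller noise is a contraction of the larger one, and contractions keep points of A in A.
  have : whiteGaussian n s = (whiteGaussian n t).map (fun x => Real.sqrt (s / t) • x) := by
    rw [map_smul_whiteGaussian ht.le, Real.sq_sqrt (by positivity), div_mul_cancel₀ _ ht.ne']
  rw [this, Measure.map_apply (by fun_prop) hA.compl]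
  exact measure_mono fun x hx hxA => hx (hstar x hxA _ (Real.sqrt_nonneg _) hc)

end WhiteGaussian

/-! ### Voronoi regions, ties and the crypto lemma -/

open scoped Pointwise

namespace EucLattice

variable {n : ℕ} (L : EucLattice n)

instance : Countable L.pts := by
  have := L.discrete
  exact countable_of_Lindelof_of_discrete

/-- The points that have no unique nearest lattice point, together with the other points equidistant from two
lattice points. -/
def ties : Set (EuclideanSpace ℝ (Fin n)) :=
  {x | ∃ p ∈ L.pts, ∃ q ∈ L.pts, p ≠ q ∧ ‖x - p‖ = ‖x - q‖}

/-- The interior of the Voronoi region. -/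
def strictVoronoi : Set (EuclideanSpace ℝ (Fin n)) :=
  {x | ∀ y ∈ L.pts, y ≠ 0 → 2 * inner ℝ x y < ‖y‖ ^ 2}

/-- Ties lie on countably many perpendicular bisectors, each a null hyperplane. This makes the
tie-breaking rule irrelevant to every probability below. -/
lemma volume_ties : volume L.ties = 0 := by
  have : L.ties ⊆ ⋃ pq : L.pts × L.pts, ⋃ _ : (pq.1 : EuclideanSpace ℝ (Fin n)) ≠ pq.2,
      (AffineSubspace.perpBisector (pq.1 : EuclideanSpace ℝ (Fin n)) pq.2 : Set _) := by
    rintro x ⟨p, hp, q, hq, hpq, h⟩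
    simp only [Set.mem_iUnion]
    refine ⟨(⟨p, hp⟩, ⟨q, hq⟩), hpq, ?_⟩
    rw [SetLike.mem_coe, AffineSubspace.mem_perpBisector_iff_dist_eq, dist_eq_norm, dist_eq_norm]
    exact h
  refine measure_mono_null this (measure_iUnion_null fun pq => measure_iUnion_null fun h => ?_)
  exact Measure.addHaar_affineSubspace _ _ (by simpa using h)

lemma measurableSet_voronoi : MeasurableSet L.voronoi :=
  L.measurable_Q (measurableSet_singleton 0)

lemma measurable_mod : Measurable L.mod :=
  measurable_id.sub L.measurable_Q

lemma measurableSet_strictVoronoi : MeasurableSet L.strictVoronoi := by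
  have : L.strictVoronoi = ⋂ y : L.pts, {x | (y : EuclideanSpace ℝ (Fin n)) ≠ 0 →
      2 * inner ℝ x (y : EuclideanSpace ℝ (Fin n)) < ‖(y : EuclideanSpace ℝ (Fin n))‖ ^ 2} := by
    ext x
    simp [strictVoronoi]
  rw [this]
  refine MeasurableSet.iInter fun y => ?_
  by_cases hy : (y : EuclideanSpace ℝ (Fin n)) = 0
  · simp [hy]
  · simp only [ne_eq, hy, not_false_eq_true, true_imp_iff]
    exact measurableSet_lt (by fun_prop) (by fun_prop)

/-- Each defining inequality is linear in x with a positive right-hand side. Star-shapedness is what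
makes the escape probability monotone in the noise variance. -/
lemma smul_mem_strictVoronoi {x : EuclideanSpace ℝ (Fin n)} (hx : x ∈ L.strictVoronoi) {c : ℝ}
    (hc : 0 ≤ c) (hc1 : c ≤ 1) : c • x ∈ L.strictVoronoi := by
  intro y hy hy0
  have h := hx y hy hy0
  have hpos : 0 < ‖y‖ ^ 2 := by positivity
  rw [real_inner_smul_left]
  rcases hc.eq_or_lt with rfl | hc
  · simpa using hpos
  · nlinarith [mul_lt_mul_of_pos_left h hc, mul_le_mul_of_nonneg_right hc1 hpos.le]

lemma norm_lt_of_mem_strictVoronoi {x y : EuclideanSpace ℝ (Fin n)} (hx : x ∈ L.strictVoronoi)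
    (hy : y ∈ L.pts) (hy0 : y ≠ 0) : ‖x‖ < ‖x - y‖ := by
  have := hx y hy hy0
  have h2 := norm_sub_sq_real x y
  exact lt_of_pow_lt_pow_left₀ 2 (norm_nonneg _) (by linarith)

/-- The quantizer is equivariant at translates of interior points of the Voronoi region. -/
lemma Q_add_of_mem_strictVoronoi {x p : EuclideanSpace ℝ (Fin n)} (hx : x ∈ L.strictVoronoi)
    (hp : p ∈ L.pts) : L.Q (x + p) = p := by
  by_contra h
  have h1 := L.norm_lt_of_mem_strictVoronoi hx (L.pts.sub_mem (L.Q_mem (x + p)) hp)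
    (sub_ne_zero.2 h)
  have h2 := L.Q_nearest (x + p) p hp
  rw [add_sub_cancel_right, show x + p - L.Q (x + p) = x - (L.Q (x + p) - p) by abel] at h2
  exact absurd h1 (not_lt.2 h2)

lemma Q_of_mem_strictVoronoi {x : EuclideanSpace ℝ (Fin n)} (hx : x ∈ L.strictVoronoi) :
    L.Q x = 0 := by
  simpa using L.Q_add_of_mem_strictVoronoi hx L.pts.zero_mem

lemma strictVoronoi_subset : L.strictVoronoi ⊆ L.voronoi :=
  fun _ hx => L.Q_of_mem_strictVoronoi hx

/-- If y violates the strict inequality, then Q x + y is at least as close to x as the nearest point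
Q x, hence equally close, and x is a tie. -/
lemma sub_Q_mem_strictVoronoi {x : EuclideanSpace ℝ (Fin n)} (hx : x ∉ L.ties) :
    L.mod x ∈ L.strictVoronoi := by
  intro y hy hy0
  by_contra! h
  refine hx ⟨L.Q x, L.Q_mem x, L.Q x + y, L.pts.add_mem (L.Q_mem x) hy, by simpa using hy0, ?_⟩
  refine le_antisymm (L.Q_nearest x _ (L.pts.add_mem (L.Q_mem x) hy)) ?_
  have h2 := norm_sub_sq_real (L.mod x) y
  rw [show x - (L.Q x + y) = L.mod x - y by rw [mod]; abel]
  exact le_of_sq_le_sq (by change _ ≤ ‖L.mod x‖ ^ 2; linarith) (norm_nonneg _)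

lemma voronoi_diff_subset : L.voronoi \ L.strictVoronoi ⊆ L.ties := by
  rintro x ⟨hx, hx'⟩
  by_contra h
  have := L.sub_Q_mem_strictVoronoi h
  rw [mod, show L.Q x = 0 from hx, sub_zero] at this
  exact hx' this

lemma strictVoronoi_ae_eq : L.strictVoronoi =ᵐ[volume] L.voronoi :=
  L.strictVoronoi_subset.eventuallyLE.antisymm
    (ae_le_set.2 (measure_mono_null L.voronoi_diff_subset L.volume_ties))

/-- Translates are disjoint because the quantizer recovers the translation vector from any point of
the translate; they cover everything but the ties. -/
lemma isAddFundamentalDomain :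
    IsAddFundamentalDomain L.pts.toAddSubgroup L.strictVoronoi volume where
  nullMeasurableSet := L.measurableSet_strictVoronoi.nullMeasurableSet
  ae_covers := by
    have : ∀ᵐ x ∂volume, x ∉ L.ties := measure_eq_zero_iff_ae_notMem.1 L.volume_ties
    filter_upwards [this] with x hx
    refine ⟨⟨-L.Q x, L.pts.neg_mem (L.Q_mem x)⟩, ?_⟩
    have := L.sub_Q_mem_strictVoronoi hx
    rwa [mod, sub_eq_neg_add] at this
  aedisjoint := by
    rintro ⟨p, hp⟩ ⟨q, hq⟩ hpq
    refine Disjoint.aedisjoint (Set.disjoint_left.2 ?_)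
    rintro _ ⟨x, hx, rfl⟩ ⟨y, hy, hxy⟩
    change q + y = p + x at hxy
    refine hpq (Subtype.ext ?_)
    change p = q
    rw [← L.Q_add_of_mem_strictVoronoi hx hp, ← L.Q_add_of_mem_strictVoronoi hy hq, add_comm x,
      add_comm y, hxy]

/-- The modulo reduction of a shifted uniform variable on the Voronoi region is uniform. -/
lemma map_mod_add_restrict_voronoi (x : EuclideanSpace ℝ (Fin n)) :
    (volume.restrict L.voronoi).map (fun y => L.mod (x + y)) = volume.restrict L.voronoi := by
  rw [← Measure.restrict_congr_set L.strictVoronoi_ae_eq]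
  ext A hA
  have hmeas : Measurable fun y => L.mod (x + y) := L.measurable_mod.comp (measurable_const_add x)
  rw [Measure.map_apply hmeas hA, Measure.restrict_apply (hmeas hA), Measure.restrict_apply hA]
  -- B is the periodic extension of the part of A in the open cell. Off the ties, mod z ∈ A exactly
  -- when z ∈ B.
  set B : Set (EuclideanSpace ℝ (Fin n)) :=
    ⋃ p : L.pts.toAddSubgroup, (fun z => z - (p : EuclideanSpace ℝ (Fin n))) ⁻¹'
      (A ∩ L.strictVoronoi) with hB
  have hBm : MeasurableSet B :=
    MeasurableSet.iUnion (ι := L.pts) fun p =>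
      (measurable_sub_const _) (hA.inter L.measurableSet_strictVoronoi)
  have hmemB : ∀ z, z ∉ L.ties → (L.mod z ∈ A ↔ z ∈ B) := by
    intro z hz
    simp only [hB, Set.mem_iUnion, Set.mem_preimage]
    constructor
    · intro h
      exact ⟨⟨L.Q z, L.Q_mem z⟩, h, L.sub_Q_mem_strictVoronoi hz⟩
    · rintro ⟨⟨p, hp⟩, h, h'⟩
      have := L.Q_add_of_mem_strictVoronoi h' hp
      simp only [sub_add_cancel] at this
      rwa [mod, this]
  have hBinv : ∀ g : L.pts.toAddSubgroup, (fun z => g +ᵥ z) ⁻¹' B = B := by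
    intro g
    ext z
    simp only [hB, Set.mem_preimage, Set.mem_iUnion]
    constructor
    · rintro ⟨p, hp⟩
      refine ⟨p - g, ?_⟩
      convert hp using 1
      change z - ((p : EuclideanSpace ℝ (Fin n)) - g) = g + z - p
      abel
    · rintro ⟨p, hp⟩
      refine ⟨p + g, ?_⟩
      convert hp using 1
      change g + z - ((p : EuclideanSpace ℝ (Fin n)) + g) = z - p
      abel
  have hnull : ∀ᵐ z ∂(volume : Measure (EuclideanSpace ℝ (Fin n))), z ∉ L.ties :=
    measure_eq_zero_iff_ae_notMem.1 L.volume_ties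
  have hBV : (B ∩ L.strictVoronoi : Set _) =ᵐ[volume] (A ∩ L.strictVoronoi : Set _) := by
    filter_upwards [hnull] with z hz
    refine propext ⟨fun h => ⟨?_, h.2⟩, fun h => ⟨?_, h.2⟩⟩
    · have := (hmemB z hz).2 h.1
      rwa [mod, L.Q_of_mem_strictVoronoi h.2, sub_zero] at this
    · refine (hmemB z hz).1 ?_
      rw [mod, L.Q_of_mem_strictVoronoi h.2, sub_zero]
      exact h.1
  have : Countable L.pts.toAddSubgroup := inferInstanceAs (Countable L.pts)
  have hdom := L.isAddFundamentalDomain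
  have hdom' : IsAddFundamentalDomain L.pts.toAddSubgroup (x +ᵥ L.strictVoronoi) volume :=
    hdom.vadd_of_comm x
  -- A periodic set has the same volume in any two fundamental domains, here the cell and its
  -- translate by x.
  rw [← measure_congr hBV, hdom.measure_set_eq hdom' hBm hBinv,
    ← measure_preimage_add volume x (B ∩ (x +ᵥ L.strictVoronoi))]
  refine measure_congr ?_
  have hnull' : ∀ᵐ z ∂(volume : Measure (EuclideanSpace ℝ (Fin n))), x + z ∉ L.ties :=
    (measurePreserving_add_left volume x).quasiMeasurePreserving.ae hnull
  filter_upwards [hnull'] with z hz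
  refine propext (and_congr (hmemB _ hz) ?_)
  exact (Set.vadd_mem_vadd_set_iff (a := x) (s := L.strictVoronoi) (x := z)).symm

/-- The quantization error with a uniform dither is distributed as the negative of the dither. -/
lemma map_quantization_error (x : EuclideanSpace ℝ (Fin n)) :
    (cond volume L.voronoi).map (fun y => L.Q (x + y) - y - x)
      = (cond volume L.voronoi).map (fun y => -y) := by
  have hmeas : Measurable fun y => L.mod (x + y) := L.measurable_mod.comp (measurable_const_add x)
  have : (fun y => L.Q (x + y) - y - x) = (fun y => -y) ∘ fun y => L.mod (x + y) := by
    ext1 y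
    simp only [mod, Function.comp_apply]
    abel
  rw [this, ← Measure.map_map measurable_neg hmeas, ProbabilityTheory.cond, Measure.map_smul,
    map_mod_add_restrict_voronoi]

end EucLattice

/-! ### Ball volumes and Gaussian domination of the dither -/

/-- A Stirling-type upper bound for the Gamma function, up to a subexponential factor. -/
lemma Gamma_add_one_le {s θ : ℝ} (hs : 0 < s) (hθ : 0 < θ) (hθ1 : θ < 1) :
    Real.Gamma (s + 1) ≤ (s / (θ * Real.exp 1)) ^ s / (1 - θ) := by
  rw [Real.Gamma_eq_integral (by linarith)]
  have hI : ∫ x in Set.Ioi (0 : ℝ), Real.exp ((θ - 1) * x) = 1 / (1 - θ) := by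
    rw [integral_exp_mul_Ioi (by linarith)]
    have : θ - 1 ≠ 0 := by linarith
    have : 1 - θ ≠ 0 := by linarith
    simp only [mul_zero, Real.exp_zero]
    rw [neg_div, ← div_neg]
    congr 1
    ring
  -- The function x^s e^{−θx} is maximal at x = s/θ, with value (s/(θe))^s; the remaining factor
  -- e^{−(1−θ)x} keeps the integral finite.
  have hle : ∀ x ∈ Set.Ioi (0 : ℝ), Real.exp (-x) * x ^ (s + 1 - 1)
      ≤ (s / (θ * Real.exp 1)) ^ s * Real.exp ((θ - 1) * x) := by
    intro x hx
    have hx : 0 < x := hx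
    rw [add_sub_cancel_right, Real.rpow_def_of_pos hx, Real.rpow_def_of_pos (by positivity),
      ← Real.exp_add, ← Real.exp_add, Real.exp_le_exp]
    have h1 : Real.log (s / (θ * Real.exp 1)) = Real.log s - Real.log θ - 1 := by
      rw [Real.log_div hs.ne' (by positivity), Real.log_mul hθ.ne' (Real.exp_ne_zero _),
        Real.log_exp]
      ring
    have h2 := Real.log_le_sub_one_of_pos (show 0 < θ * x / s by positivity)
    rw [Real.log_div (by positivity) hs.ne', Real.log_mul hθ.ne' hx.ne'] at h2
    have h3 : s * (θ * x / s - 1) = θ * x - s := by field_simp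
    have h4 := mul_le_mul_of_nonneg_left h2 hs.le
    rw [h3] at h4
    rw [h1]
    nlinarith
  calc _ ≤ ∫ x in Set.Ioi (0 : ℝ), (s / (θ * Real.exp 1)) ^ s * Real.exp ((θ - 1) * x) := by
        refine setIntegral_mono_on (Real.GammaIntegral_convergent (by linarith))
          (Integrable.const_mul ?_ _) measurableSet_Ioi hle
        exact integrableOn_exp_mul_Ioi (by linarith) 0
    _ = _ := by rw [integral_const_mul, hI, mul_one_div]

/-- A lower bound for the volume of the unit ball, tight up to a subexponential factor. -/
lemma le_volume_ball {n : ℕ} (hn : 0 < n) {θ : ℝ} (hθ : 0 < θ) (hθ1 : θ < 1) :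
    (1 - θ) * (2 * Real.pi * Real.exp 1 * θ / n) ^ (n / 2 : ℝ)
      ≤ volume.real (Metric.ball (0 : EuclideanSpace ℝ (Fin n)) 1) := by
  have hn' : (0 : ℝ) < n := by exact_mod_cast hn
  have : Nonempty (Fin n) := ⟨⟨0, hn⟩⟩
  have hΓ : 0 < Real.Gamma (n / 2 + 1 : ℝ) := Real.Gamma_pos_of_pos (by positivity)
  have hG := Gamma_add_one_le (show (0 : ℝ) < n / 2 by positivity) hθ hθ1
  rw [measureReal_def, EuclideanSpace.volume_ball, Fintype.card_fin, ENNReal.ofReal_one, one_pow,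
    one_mul, ENNReal.toReal_ofReal (by positivity), le_div_iff₀ hΓ]
  calc _ ≤ (1 - θ) * (2 * Real.pi * Real.exp 1 * θ / n) ^ (n / 2 : ℝ)
        * ((n / 2 / (θ * Real.exp 1)) ^ (n / 2 : ℝ) / (1 - θ)) := by
        have : 0 < 1 - θ := by linarith
        gcongr
    _ = ((2 * Real.pi * Real.exp 1 * θ / n) * (n / 2 / (θ * Real.exp 1))) ^ (n / 2 : ℝ) := by
        rw [Real.mul_rpow (by positivity) (by positivity)]
        have : 1 - θ ≠ 0 := by linarith
        field_simp
    _ = Real.pi ^ (n / 2 : ℝ) := by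
        congr 1
        field_simp
    _ = _ := by
        rw [Real.sqrt_eq_rpow, ← Real.rpow_natCast, ← Real.rpow_mul Real.pi_pos.le]
        congr 1
        ring

namespace EucLattice

variable {n : ℕ} (L : EucLattice n)

lemma rCov_nonneg : 0 ≤ L.rCov := Real.sInf_nonneg fun _ h => h.1

lemma rEff_nonneg : 0 ≤ L.rEff := by
  unfold rEff vol
  positivity

/-- The infimum of the empty set is 0, so a positive covering radius already shows that some ball
contains the cell; boundedness needs no separate proof. -/
lemma voronoi_subset_closedBall (h : 0 < L.rCov) :
    L.voronoi ⊆ Metric.closedBall 0 L.rCov := by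
  have hne : {r : ℝ | 0 ≤ r ∧ L.voronoi ⊆ Metric.closedBall 0 r}.Nonempty := by
    by_contra hne
    rw [rCov, Set.not_nonempty_iff_eq_empty.1 hne, Real.sInf_empty] at h
    exact lt_irrefl _ h
  intro x hx
  rw [mem_closedBall_zero_iff]
  exact le_csInf hne fun r hr => mem_closedBall_zero_iff.1 (hr.2 hx)

lemma volume_voronoi_ne_top (h : 0 < L.rCov) : volume L.voronoi ≠ ⊤ :=
  ((measure_mono (L.voronoi_subset_closedBall h)).trans_lt
    measure_closedBall_lt_top).ne

lemma volume_ball_pos : 0 < volume.real (Metric.ball (0 : EuclideanSpace ℝ (Fin n)) 1) :=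
  ENNReal.toReal_pos (Metric.measure_ball_pos _ _ one_pos).ne' measure_ball_lt_top.ne

lemma rEff_pow (hn : 0 < n) :
    L.rEff ^ n * volume.real (Metric.ball (0 : EuclideanSpace ℝ (Fin n)) 1) = L.vol := by
  have hn' : (n : ℝ) ≠ 0 := by exact_mod_cast hn.ne'
  have hV : 0 ≤ L.vol := measureReal_nonneg
  have := volume_ball_pos (n := n)
  rw [rEff, ← Real.rpow_natCast, ← Real.rpow_mul (by positivity), one_div_mul_cancel hn',
    Real.rpow_one, div_mul_cancel₀ _ this.ne']

lemma vol_pos (hn : 0 < n) (hr : 0 < L.rEff) : 0 < L.vol := by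
  rw [← L.rEff_pow hn]
  exact mul_pos (pow_pos hr _) volume_ball_pos

/-- If the covering radius is close to the effective radius, then the uniform distribution on the
Voronoi region is dominated by a white Gaussian one. -/
lemma cond_voronoi_le (hn : 0 < n) {η : ℝ} (hη : 0 < η) (hR : 0 < L.rCov) (hr : 0 < L.rEff)
    (hRr : L.rCov ≤ Real.exp (η / 4) * L.rEff)
    (hbig : 1 ≤ (1 - Real.exp (-η)) * Real.exp (n * (η / 4))) :
    ProbabilityTheory.cond volume L.voronoi
      ≤ ENNReal.ofReal (Real.exp (n * η)) • whiteGaussian n (L.rCov ^ 2 / n) := by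
  have hn' : (0 : ℝ) < n := by exact_mod_cast hn
  have hvol := L.vol_pos hn hr
  set R := L.rCov with hRdef
  have hθ1 : Real.exp (-η) < 1 := Real.exp_lt_one_iff.2 (by linarith)
  have hball := le_volume_ball hn (Real.exp_pos (-η)) hθ1
  -- On the ball of radius R the Gaussian density of variance R²/n is at least the inverse of the
  -- left side, so this compares it with 1/vol. The budget nη is spent as nη/4 on R/r_eff, nη/2 on
  -- θ^{n/2} with θ = e^{−η}, and nη/4 on the prefactor 1 − θ.
  have key : (2 * Real.pi * (R ^ 2 / n)) ^ (n / 2 : ℝ) * Real.exp (n / 2)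
      ≤ Real.exp (n * η) * L.vol := by
    calc (2 * Real.pi * (R ^ 2 / n)) ^ (n / 2 : ℝ) * Real.exp (n / 2)
        = R ^ n * (2 * Real.pi * Real.exp 1 / n) ^ (n / 2 : ℝ) := by
          have h1 : Real.exp (n / 2) = Real.exp 1 ^ (n / 2 : ℝ) := (Real.exp_one_rpow _).symm
          have h2 : R ^ n = (R ^ 2) ^ (n / 2 : ℝ) := by
            rw [← Real.rpow_natCast, ← Real.rpow_natCast, ← Real.rpow_mul hR.le]
            congr 1
            push_cast
            ring
          rw [h1, h2, ← Real.mul_rpow (by positivity) (by positivity),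
            ← Real.mul_rpow (by positivity) (by positivity)]
          congr 1
          ring
      _ ≤ (Real.exp (η / 4) * L.rEff) ^ n * (2 * Real.pi * Real.exp 1 / n) ^ (n / 2 : ℝ) := by
          gcongr
      _ = Real.exp (n * (η / 4)) * (L.rEff ^ n * (2 * Real.pi * Real.exp 1 / n) ^ (n / 2 : ℝ)) := by
          rw [mul_pow, ← Real.exp_nat_mul]
          ring
      _ ≤ ((1 - Real.exp (-η)) * Real.exp (n * (η / 4))) * (Real.exp (n * (η / 4)) *
            (L.rEff ^ n * (2 * Real.pi * Real.exp 1 / n) ^ (n / 2 : ℝ))) :=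
          le_mul_of_one_le_left (by positivity) hbig
      _ = Real.exp (n * η) * (L.rEff ^ n * ((1 - Real.exp (-η)) *
            (2 * Real.pi * Real.exp 1 * Real.exp (-η) / n) ^ (n / 2 : ℝ))) := by
          have h1 : (2 * Real.pi * Real.exp 1 * Real.exp (-η) / n) ^ (n / 2 : ℝ)
              = Real.exp (-(n * (η / 2))) * (2 * Real.pi * Real.exp 1 / n) ^ (n / 2 : ℝ) := by
            rw [show 2 * Real.pi * Real.exp 1 * Real.exp (-η) / n
              = Real.exp (-η) * (2 * Real.pi * Real.exp 1 / n) by ring,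
              Real.mul_rpow (by positivity) (by positivity), ← Real.exp_mul]
            congr 2
            ring
          have h2 : Real.exp (n * η) * Real.exp (-(n * (η / 2)))
              = Real.exp (n * (η / 4)) * Real.exp (n * (η / 4)) := by
            rw [← Real.exp_add, ← Real.exp_add]
            congr 1
            ring
          rw [h1]
          linear_combination (-(L.rEff ^ n * (1 - Real.exp (-η)) *
            (2 * Real.pi * Real.exp 1 / n) ^ (n / 2 : ℝ))) * h2
      _ ≤ Real.exp (n * η) * L.vol := by
          rw [← L.rEff_pow hn]
          gcongr
  have hs : 0 < R ^ 2 / n := by positivity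
  rw [whiteGaussian_eq_withDensity hs, ← withDensity_smul _ (by fun_prop), ProbabilityTheory.cond,
    ← withDensity_one (μ := volume.restrict L.voronoi), ← withDensity_smul _ measurable_one,
    ← withDensity_indicator L.measurableSet_voronoi]
  refine withDensity_mono (ae_of_all _ fun x => ?_)
  by_cases hx : x ∈ L.voronoi
  swap
  · simp [hx]
  have hxR : ‖x‖ ≤ R := mem_closedBall_zero_iff.1 (L.voronoi_subset_closedBall hR hx)
  simp only [hx, Set.indicator_of_mem, Pi.smul_apply, Pi.one_apply, smul_eq_mul, mul_one]
  have hvol' : volume L.voronoi = ENNReal.ofReal L.vol :=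
    (ofReal_measureReal (L.volume_voronoi_ne_top hR)).symm
  rw [hvol', ← ENNReal.ofReal_inv_of_pos hvol, ← ENNReal.ofReal_mul (Real.exp_pos _).le]
  refine ENNReal.ofReal_le_ofReal ?_
  have hexp : Real.exp (-(n / 2 : ℝ)) ≤ Real.exp (-‖x‖ ^ 2 / (2 * (R ^ 2 / n))) := by
    rw [Real.exp_le_exp, neg_div, neg_le_neg_iff, div_le_iff₀ (by positivity)]
    have : (n / 2 : ℝ) * (2 * (R ^ 2 / n)) = R ^ 2 := by field_simp
    rw [this]
    gcongr
  calc L.vol⁻¹ ≤ Real.exp (n * η) *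
        ((2 * Real.pi * (R ^ 2 / n)) ^ (-(n / 2 : ℝ)) * Real.exp (-(n / 2 : ℝ))) := by
        rw [Real.rpow_neg (by positivity), Real.exp_neg, ← mul_inv, ← div_eq_mul_inv,
          le_div_iff₀ (by positivity), inv_mul_le_iff₀ hvol, mul_comm L.vol]
        exact key
    _ ≤ _ := by gcongr

/-- The second moment of a lattice is at least roughly that of a ball of the same volume. -/
lemma le_sigmaSq (hn : 0 < n) (hR : 0 < L.rCov) (hr : 0 < L.rEff) {c : ℝ} (hc : 0 < c) :
    c ^ 2 * (1 - c ^ n) * L.rEff ^ 2 / n ≤ L.sigmaSq := by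
  have hn' : (0 : ℝ) < n := by exact_mod_cast hn
  have hvol := L.vol_pos hn hr
  have htop := L.volume_voronoi_ne_top hR
  have hint : IntegrableOn (fun x : EuclideanSpace ℝ (Fin n) => ‖x‖ ^ 2) L.voronoi := by
    refine IntegrableOn.mono_set (t := Metric.closedBall 0 L.rCov) ?_
      (L.voronoi_subset_closedBall hR)
    exact (by fun_prop : Continuous fun x : EuclideanSpace ℝ (Fin n) => ‖x‖ ^ 2).continuousOn
      |>.integrableOn_compact (isCompact_closedBall _ _)
  -- This ball has only the fraction c^n of the cell's volume, so at least 1 − c^n of the cell lies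
  -- at distance ≥ c·r_eff from 0.
  set B := Metric.ball (0 : EuclideanSpace ℝ (Fin n)) (c * L.rEff) with hB
  have hBvol : volume.real B = c ^ n * L.vol := by
    rw [hB, measureReal_def, Measure.addHaar_ball_of_pos _ _ (by positivity),
      ENNReal.toReal_mul, ENNReal.toReal_ofReal (by positivity), finrank_euclideanSpace,
      Fintype.card_fin, mul_pow, ← L.rEff_pow hn, ← measureReal_def, mul_assoc]
  have h1 : (c * L.rEff) ^ 2 * (L.vol - c ^ n * L.vol) ≤ ∫ x in L.voronoi, ‖x‖ ^ 2 := by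
    calc _ ≤ (c * L.rEff) ^ 2 * volume.real (L.voronoi \ B) := by
          gcongr
          rw [← hBvol]
          exact le_measureReal_sdiff measure_ball_lt_top.ne
      _ = ∫ x in L.voronoi \ B, (c * L.rEff) ^ 2 := by
          rw [setIntegral_const, smul_eq_mul, mul_comm]
      _ ≤ ∫ x in L.voronoi \ B, ‖x‖ ^ 2 := by
          refine setIntegral_mono_on ?_ (hint.mono_set Set.sdiff_subset)
            (L.measurableSet_voronoi.diff measurableSet_ball) fun x hx => ?_
          · exact integrableOn_const
              ((measure_mono Set.sdiff_subset).trans_lt htop.lt_top).ne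
          · have : c * L.rEff ≤ ‖x‖ := by simpa [hB] using hx.2
            gcongr
      _ ≤ _ := setIntegral_mono_set hint (ae_of_all _ fun x => by positivity)
          (Set.sdiff_subset.eventuallyLE)
  rw [sigmaSq, div_le_iff₀ hn', one_div_mul_eq_div, div_mul_eq_mul_div, le_div_iff₀ (by positivity)]
  nlinarith

end EucLattice

/-- For lattices that are good for covering, the dither is dominated by white Gaussian noise of
nearly the same power. -/
lemma GoodForCovering.eventually_dominated {L : ∀ n : ℕ, EucLattice n} (h : GoodForCovering L)
    {η : ℝ} (hη : 0 < η) :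
    ∀ᶠ n in atTop, ∃ s : ℝ, 0 < s ∧ s ≤ (1 + η) * (L n).sigmaSq ∧
      ProbabilityTheory.cond volume (L n).voronoi
        ≤ ENNReal.ofReal (Real.exp (n * η)) • whiteGaussian n s := by
  -- Then c < 1 while (1 + η)c² = (1 + η)^{1/2} > 1, which leaves room for c^n and for the ratio
  -- r_cov/r_eff.
  set c : ℝ := (1 + η) ^ (-(1 / 4) : ℝ) with hcdef
  have hc : 0 < c := by positivity
  have hc1 : c < 1 := Real.rpow_lt_one_of_one_lt_of_neg (by linarith) (by norm_num)
  have hcpow : 1 < (1 + η) * c ^ 2 := by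
    have : (1 + η) * c ^ 2 = (1 + η) ^ (1 / 2 : ℝ) := by
      rw [hcdef, ← Real.rpow_natCast, ← Real.rpow_mul (by linarith)]
      nth_rewrite 1 [← Real.rpow_one (1 + η)]
      rw [← Real.rpow_add (by linarith)]
      norm_num
    rw [this]
    exact Real.one_lt_rpow (by linarith) (by norm_num)
  have hlim1 : Tendsto (fun n : ℕ => (1 + η) * (c ^ 2 * (1 - c ^ n)) - ((L n).rCov / (L n).rEff) ^ 2)
      atTop (𝓝 ((1 + η) * (c ^ 2 * (1 - 0)) - 1 ^ 2)) :=
    (((tendsto_const_nhds.sub (tendsto_pow_atTop_nhds_zero_of_lt_one hc.le hc1)).const_mul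
      _).const_mul _).sub (Tendsto.pow h 2)
  have hlim2 : Tendsto (fun n : ℕ => (1 - Real.exp (-η)) * Real.exp (n * (η / 4))) atTop atTop := by
    refine Tendsto.const_mul_atTop (sub_pos.2 (Real.exp_lt_one_iff.2 (by linarith))) ?_
    exact Real.tendsto_exp_atTop.comp
      (tendsto_natCast_atTop_atTop.atTop_mul_const (by positivity))
  -- A nonzero ratio forces both radii to be nonzero, which excludes their default values.
  filter_upwards [eventually_gt_atTop 0, h.eventually_ne one_ne_zero,
    h.eventually_lt_const (Real.one_lt_exp_iff.2 (show 0 < η / 4 by positivity)),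
    hlim1.eventually_const_lt (u := 0) (by linarith), hlim2.eventually_ge_atTop 1]
    with n hn hne hlt hpos hbig
  obtain ⟨hR, hr⟩ := div_ne_zero_iff.1 hne
  have hR : 0 < (L n).rCov := (L n).rCov_nonneg.lt_of_ne' hR
  have hr : 0 < (L n).rEff := (L n).rEff_nonneg.lt_of_ne' hr
  have hn' : (0 : ℝ) < n := by exact_mod_cast hn
  refine ⟨(L n).rCov ^ 2 / n, by positivity, ?_,
    (L n).cond_voronoi_le hn hη hR hr ((div_lt_iff₀ hr).1 hlt).le hbig⟩
  have h1 := (L n).le_sigmaSq hn hR hr hc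
  have h2 : (L n).rCov ^ 2 ≤ (1 + η) * (c ^ 2 * (1 - c ^ n)) * (L n).rEff ^ 2 := by
    rw [← div_le_iff₀ (by positivity), ← div_pow]
    linarith
  calc (L n).rCov ^ 2 / n ≤ (1 + η) * (c ^ 2 * (1 - c ^ n)) * (L n).rEff ^ 2 / n := by gcongr
    _ = (1 + η) * (c ^ 2 * (1 - c ^ n) * (L n).rEff ^ 2 / n) := by ring
    _ ≤ _ := by gcongr

/-! ### The source and the quantization noise -/

section Source

variable {V : Type*} [Fintype V] {T : SimpleGraph V} {ν : Measure (V → ℝ)}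

lemma IsGaussianMarkovTree.memLp_eval (h : IsGaussianMarkovTree T ν) (v : V) :
    MemLp (fun x : V → ℝ => x v) 2 ν := by
  have := h.isGaussian
  exact IsGaussian.memLp_dual ν (ContinuousLinearMap.proj (R := ℝ) (φ := fun _ : V => ℝ) v) 2
    (by simp)

lemma IsGaussianMarkovTree.integral_sq (h : IsGaussianMarkovTree T ν) (u v : V) (a b : ℝ) :
    ∫ x, (a * x u + b * x v) ^ 2 ∂ν = a ^ 2 + b ^ 2 + 2 * a * b * corr ν u v := by
  have hu := h.memLp_eval u
  have hv := h.memLp_eval v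
  have huv : Integrable (fun x : V → ℝ => x u * x v) ν := hu.integrable_mul hv
  have : ∀ x : V → ℝ, (a * x u + b * x v) ^ 2
      = a ^ 2 * x u ^ 2 + b ^ 2 * x v ^ 2 + 2 * a * b * (x u * x v) := fun x => by ring
  simp_rw [this]
  have hsum : Integrable (fun x : V → ℝ => a ^ 2 * x u ^ 2 + b ^ 2 * x v ^ 2) ν :=
    (hu.integrable_sq.const_mul _).add (hv.integrable_sq.const_mul _)
  rw [integral_add hsum (huv.const_mul _), integral_add (hu.integrable_sq.const_mul _) (hv.integrable_sq.const_mul _),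
    integral_const_mul, integral_const_mul, integral_const_mul, h.unit_variance, h.unit_variance,
    corr]
  ring

lemma IsGaussianMarkovTree.variance_nonneg (h : IsGaussianMarkovTree T ν) (u v : V) (a b : ℝ) :
    0 ≤ a ^ 2 + b ^ 2 + 2 * a * b * corr ν u v := by
  rw [← h.integral_sq]
  positivity

lemma IsGaussianMarkovTree.map_linear (h : IsGaussianMarkovTree T ν) (u v : V) (a b : ℝ) :
    ν.map (fun x => a * x u + b * x v)
      = gaussianReal 0 (a ^ 2 + b ^ 2 + 2 * a * b * corr ν u v).toNNReal := by
  have := h.isGaussian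
  let ℓ : StrongDual ℝ (V → ℝ) := a • ContinuousLinearMap.proj (R := ℝ) (φ := fun _ : V => ℝ) u
    + b • ContinuousLinearMap.proj (R := ℝ) (φ := fun _ : V => ℝ) v
  have hℓ : ⇑ℓ = fun x : V → ℝ => a * x u + b * x v := by
    ext x
    simp [ℓ]
  have hmean : ∫ x, (a * x u + b * x v) ∂ν = 0 := by
    rw [integral_add (((h.memLp_eval u).integrable (by norm_num)).const_mul _)
      (((h.memLp_eval v).integrable (by norm_num)).const_mul _), integral_const_mul,
      integral_const_mul, h.mean_zero, h.mean_zero]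
    simp
  rw [← hℓ, IsGaussian.map_eq_gaussianReal, hℓ, hmean, variance_of_integral_eq_zero
    (by rw [← hℓ]; exact ℓ.continuous.aemeasurable) hmean, h.integral_sq]

end Source

section Noise

variable {V : Type*} {T : SimpleGraph V} {ν : Measure (V → ℝ)} {Ω : Type*} [MeasurableSpace Ω]
  {P : Measure Ω} {L : ∀ n : ℕ, V → EucLattice n} {X : V → ℕ → Ω → ℝ}
  {d : ∀ n : ℕ, V → ℕ → Ω → EuclideanSpace ℝ (Fin n)}

lemma IsSourceWithDithers.hasLaw_block [Fintype V] [IsProbabilityMeasure P]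
    (hT : IsGaussianMarkovTree T ν) (H : IsSourceWithDithers P ν L X d) (n i : ℕ) (u v : V)
    (a b : ℝ) :
    HasLaw (fun ω => a • block (X u) n i ω + b • block (X v) n i ω)
      (whiteGaussian n (a ^ 2 + b ^ 2 + 2 * a * b * corr ν u v)) P := by
  have hφ : Measurable fun x : V → ℝ => a * x u + b * x v := by fun_prop
  have hcoord : ∀ j : Fin n, HasLaw (fun ω => a * X u (i * n + j) ω + b * X v (i * n + j) ω)
      (gaussianReal 0 (a ^ 2 + b ^ 2 + 2 * a * b * corr ν u v).toNNReal) P := fun j =>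
    HasLaw.fun_comp (Y := fun x : V → ℝ => a * x u + b * x v)
      ⟨hφ.aemeasurable, hT.map_linear u v a b⟩ (H.source_law (i * n + j))
  have hinj : Function.Injective fun j : Fin n => i * n + (j : ℕ) := fun j k hjk =>
    Fin.ext (by simpa using hjk)
  have hindep : iIndepFun (fun (j : Fin n) ω => a * X u (i * n + j) ω + b * X v (i * n + j) ω) P :=
    (H.source_indep.comp (fun _ x => a * x u + b * x v) fun _ => hφ).precomp hinj
  have hpi := iIndepFun.hasLaw_pi hcoord hindep
  have hlaw := map_toLp_pi_gaussianReal (n := n)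
    (a ^ 2 + b ^ 2 + 2 * a * b * corr ν u v).toNNReal
  rw [Real.coe_toNNReal _ (hT.variance_nonneg u v a b)] at hlaw
  exact HasLaw.fun_comp (Y := WithLp.toLp 2) ⟨by fun_prop, hlaw⟩ hpi

lemma IsSourceWithDithers.aemeasurable_source [Countable V]
    (H : IsSourceWithDithers P ν L X d) :
    AEMeasurable (fun ω (vt : V × ℕ) => X vt.1 vt.2 ω) P :=
  aemeasurable_pi_lambda _ fun vt =>
    (measurable_pi_apply vt.1).comp_aemeasurable (H.source_law vt.2).aemeasurable

/-- The output of the dithered quantizer before modulo reduction. -/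
noncomputable def dithered {n : ℕ} (L : EucLattice n) (x d : EuclideanSpace ℝ (Fin n)) :
    EuclideanSpace ℝ (Fin n) :=
  L.Q (x + d) - d

lemma measurable_block_of_samples {n i : ℕ} (v : V) :
    Measurable fun x : V × ℕ → ℝ =>
      (WithLp.toLp 2 fun j : Fin n => x (v, i * n + j) : EuclideanSpace ℝ (Fin n)) := by
  fun_prop

lemma map_prod_linear {E : Type*} [NormedAddCommGroup E] [NormedSpace ℝ E] [MeasurableSpace E]
    [BorelSpace E] [SecondCountableTopology E] (μ U W : Measure E) [SFinite μ] [SFinite U]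
    [SFinite W] (a b : ℝ) :
    (μ.prod (U.prod W)).map (fun p => p.1 + (a • p.2.1 + b • p.2.2))
      = μ.conv ((U.map fun y => a • y).conv (W.map fun y => b • y)) := by
  unfold Measure.conv
  rw [Measure.map_prod_map U W (by fun_prop) (by fun_prop),
    Measure.map_map (by fun_prop) (by fun_prop)]
  conv_rhs => rw [← Measure.map_id (μ := μ)]
  rw [Measure.map_prod_map _ _ (by fun_prop) (by fun_prop),
    Measure.map_map (by fun_prop) (by fun_prop)]
  rfl

/-- A linear combination of the dithered quantizer outputs of two terminals is the same linear
combination of the observations, plus independent noise. -/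
lemma IsSourceWithDithers.hasLaw_dithered [Fintype V] [IsProbabilityMeasure P]
    (hT : IsGaussianMarkovTree T ν) (H : IsSourceWithDithers P ν L X d) (n i : ℕ) {u v : V}
    (huv : u ≠ v) (a b : ℝ) :
    HasLaw (fun ω => a • dithered (L n u) (block (X u) n i ω) (d n u i ω)
        + b • dithered (L n v) (block (X v) n i ω) (d n v i ω))
      ((whiteGaussian n (a ^ 2 + b ^ 2 + 2 * a * b * corr ν u v)).conv
        (((ProbabilityTheory.cond volume (L n u).voronoi).map fun y => (-a) • y).conv
          ((ProbabilityTheory.cond volume (L n v).voronoi).map fun y => (-b) • y))) P := by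
  set U := ProbabilityTheory.cond volume (L n u).voronoi with hU
  set W := ProbabilityTheory.cond volume (L n v).voronoi with hW
  have hdu := H.dither_law n u i
  have hdv := H.dither_law n v i
  have : IsProbabilityMeasure U := hdu.isProbabilityMeasure_iff.1 inferInstance
  have : IsProbabilityMeasure W := hdv.isProbabilityMeasure_iff.1 inferInstance
  let ξ : Ω → EuclideanSpace ℝ (Fin n) × EuclideanSpace ℝ (Fin n) := fun ω =>
    (block (X u) n i ω, block (X v) n i ω)
  have hξm := (measurable_block_of_samples (n := n) (i := i) u).prodMk
    (measurable_block_of_samples (n := n) (i := i) v)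
  have hξ : HasLaw ξ (P.map ξ) P := ⟨hξm.comp_aemeasurable H.aemeasurable_source, rfl⟩
  have : IsProbabilityMeasure (P.map ξ) := Measure.isProbabilityMeasure_map hξ.aemeasurable
  have hdd : HasLaw (fun ω => (d n u i ω, d n v i ω)) (U.prod W) P :=
    ((H.dither_indep n).indepFun (i := (u, i)) (j := (v, i)) (by simp [huv])).hasLaw_prod hdu hdv
  have hind : IndepFun ξ (fun ω => (d n u i ω, d n v i ω)) P :=
    (H.indep n).comp hξm ((measurable_pi_apply (u, i)).prodMk (measurable_pi_apply (v, i)))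
  have hjoint : HasLaw (fun ω => (ξ ω, (d n u i ω, d n v i ω))) ((P.map ξ).prod (U.prod W)) P :=
    hind.hasLaw_prod hξ hdd
  have hlin : MeasurePreserving (fun x : EuclideanSpace ℝ (Fin n) × EuclideanSpace ℝ (Fin n) =>
      a • x.1 + b • x.2) (P.map ξ) (whiteGaussian n (a ^ 2 + b ^ 2 + 2 * a * b * corr ν u v)) := by
    refine ⟨by fun_prop, ?_⟩
    rw [AEMeasurable.map_map_of_aemeasurable (by fun_prop) hξ.aemeasurable]
    exact (H.hasLaw_block hT n i u v a b).map_eq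
  have hQu := (L n u).measurable_Q
  have hQv := (L n v).measurable_Q
  -- Given the source blocks, the pair of quantization errors has a law that does not depend on
  -- them. The errors are therefore independent of the linear combination of the blocks.
  have hskew := hlin.skew_product (μc := U.prod W)
    (μd := (U.map fun y => -y).prod (W.map fun y => -y))
    (g := fun x y => ((L n u).Q (x.1 + y.1) - y.1 - x.1, (L n v).Q (x.2 + y.2) - y.2 - x.2))
    (by
      unfold Function.uncurry
      fun_prop)
    (ae_of_all _ fun x => by
      rw [← (L n u).map_quantization_error x.1, ← (L n v).map_quantization_error x.2,
        Measure.map_prod_map _ _ (by fun_prop) (by fun_prop)]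
      rfl)
  have hsum : HasLaw (fun p : EuclideanSpace ℝ (Fin n) ×
      (EuclideanSpace ℝ (Fin n) × EuclideanSpace ℝ (Fin n)) => p.1 + (a • p.2.1 + b • p.2.2))
      ((whiteGaussian n (a ^ 2 + b ^ 2 + 2 * a * b * corr ν u v)).conv
        ((U.map fun y => (-a) • y).conv (W.map fun y => (-b) • y)))
      ((whiteGaussian n (a ^ 2 + b ^ 2 + 2 * a * b * corr ν u v)).prod
        ((U.map fun y => -y).prod (W.map fun y => -y))) := by
    refine ⟨by fun_prop, ?_⟩
    have hUa : (U.map fun y => (-a) • y) = (U.map fun y => -y).map fun y => a • y := by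
      rw [Measure.map_map (by fun_prop) (by fun_prop)]
      congr 1
      ext1 y
      simp
    have hWb : (W.map fun y => (-b) • y) = (W.map fun y => -y).map fun y => b • y := by
      rw [Measure.map_map (by fun_prop) (by fun_prop)]
      congr 1
      ext1 y
      simp
    have hp : IsProbabilityMeasure (U.map fun y => -y) :=
      Measure.isProbabilityMeasure_map (by fun_prop)
    have hp' : IsProbabilityMeasure (W.map fun y => -y) :=
      Measure.isProbabilityMeasure_map (by fun_prop)
    rw [hUa, hWb, map_prod_linear]
  have := hsum.comp (hskew.hasLaw.comp hjoint)
  refine this.congr (ae_of_all _ fun ω => ?_)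
  simp only [dithered, Function.comp_apply, ξ, smul_sub]
  abel

end Noise

/-- If two noises are dominated by white Gaussian noise, so is their sum with independent white
Gaussian noise. -/
lemma conv_conv_le {n : ℕ} {U W : Measure (EuclideanSpace ℝ (Fin n))} {C : ENNReal} {r s t : ℝ}
    (hr : 0 ≤ r) (hs : 0 ≤ s) (ht : 0 ≤ t) (hC : C ≠ ⊤)
    (hU : U ≤ C • whiteGaussian n s) (hW : W ≤ C • whiteGaussian n t) (a b : ℝ) :
    (whiteGaussian n r).conv ((U.map fun y => a • y).conv (W.map fun y => b • y))
      ≤ (C * C) • whiteGaussian n (r + (a ^ 2 * s + b ^ 2 * t)) := by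
  have hfin : ∀ q, IsFiniteMeasure (C • whiteGaussian n q) := fun q =>
    Measure.smul_finite _ hC
  have hU' : (U.map fun y => a • y) ≤ C • whiteGaussian n (a ^ 2 * s) := by
    rw [← map_smul_whiteGaussian hs, ← Measure.map_smul]
    exact Measure.map_mono hU (by fun_prop)
  have hW' : (W.map fun y => b • y) ≤ C • whiteGaussian n (b ^ 2 * t) := by
    rw [← map_smul_whiteGaussian ht, ← Measure.map_smul]
    exact Measure.map_mono hW (by fun_prop)
  have h1 : (U.map fun y => a • y).conv (W.map fun y => b • y)
      ≤ (C * C) • whiteGaussian n (a ^ 2 * s + b ^ 2 * t) := by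
    refine (Measure.map_mono (Measure.prod_mono hU' hW') (by fun_prop)).trans_eq ?_
    change (C • whiteGaussian n (a ^ 2 * s)).conv (C • whiteGaussian n (b ^ 2 * t)) = _
    rw [Measure.conv_smul_left, Measure.conv_smul_right, smul_smul,
      whiteGaussian_conv (by positivity) (by positivity)]
  have hfin' : IsFiniteMeasure ((C * C) • whiteGaussian n (a ^ 2 * s + b ^ 2 * t)) :=
    Measure.smul_finite _ (ENNReal.mul_ne_top hC hC)
  refine (Measure.map_mono (Measure.prod_mono le_rfl h1) (by fun_prop)).trans_eq ?_
  change (whiteGaussian n r).conv ((C * C) • whiteGaussian n _) = _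
  rw [Measure.conv_smul_right, whiteGaussian_conv hr (by positivity)]

/-! ### Error probabilities -/

/-- Goodness for AWGN channel coding controls all noise variances below the nominal one. -/
lemma GoodForAWGN.eventually_le {L : ∀ n : ℕ, EucLattice n} (h : GoodForAWGN L) {μ ε : ℝ}
    (hμ : 2 * Real.pi * Real.exp 1 ≤ μ) (hε : 0 < ε) :
    ∀ᶠ n : ℕ in atTop, ∀ s : ℝ, 0 < s → s ≤ (L n).vol ^ (2 / (n : ℝ)) / μ →
      (whiteGaussian n s).real ((L n).strictVoronoi)ᶜ
        ≤ Real.exp (-(n * (poltyrevExponent μ - ε))) := by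
  obtain ⟨o, ho, hbound⟩ := h μ hμ
  filter_upwards [ho.eventually_lt_const hε] with n hn s hs hs'
  set s' := (L n).vol ^ (2 / (n : ℝ)) / μ
  -- Monotonicity is applied to the strict region, which is star-shaped whatever the tie rule; the
  -- Gaussian at s' does not see the null difference from the full region.
  have hmono : (whiteGaussian n s).real ((L n).strictVoronoi)ᶜ
      ≤ (whiteGaussian n s').real ((L n).strictVoronoi)ᶜ :=
    ENNReal.toReal_mono (measure_ne_top _ _) (whiteGaussian_compl_mono hs.le hs'
      (L n).measurableSet_strictVoronoi fun x hx c hc hc1 => (L n).smul_mem_strictVoronoi hx hc hc1)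
  have hae : (whiteGaussian n s').real ((L n).strictVoronoi)ᶜ
      = (whiteGaussian n s').real ((L n).voronoi)ᶜ :=
    measureReal_congr ((whiteGaussian_absolutelyContinuous (hs.trans_le hs')).ae_eq
      (L n).strictVoronoi_ae_eq).compl
  calc _ ≤ _ := hmono.trans (hae.trans_le (hbound n))
    _ ≤ _ := by gcongr

/-- For δ < 1 the first branch applies and gives (δ − ln(1 + δ))/2. -/
lemma poltyrevExponent_pos {δ : ℝ} (hδ : 0 < δ) (hδ1 : δ < 1) :
    0 < poltyrevExponent (2 * Real.pi * Real.exp 1 * (1 + δ)) := by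
  have hpe : 0 < Real.pi * Real.exp 1 := by positivity
  rw [poltyrevExponent, if_neg (by nlinarith), if_neg (by nlinarith)]
  have h1 : 2 * Real.pi * Real.exp 1 * (1 + δ) / (4 * Real.pi * Real.exp 1) = (1 + δ) / 2 := by
    field_simp
    ring
  have h2 : 2 * Real.pi * Real.exp 1 * (1 + δ) / (2 * Real.pi) = Real.exp 1 * (1 + δ) := by
    field_simp
  rw [h1, h2, Real.log_mul (Real.exp_ne_zero _) (by linarith), Real.log_exp]
  have := Real.log_lt_sub_one_of_pos (show 0 < 1 + δ by linarith) (by linarith)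
  linarith

section Error

variable {V : Type*} {T : SimpleGraph V} {ν : Measure (V → ℝ)} {Ω : Type*} [MeasurableSpace Ω]
  {P : Measure Ω} {L : ∀ n : ℕ, V → EucLattice n} {X : V → ℕ → Ω → ℝ}
  {d : ∀ n : ℕ, V → ℕ → Ω → EuclideanSpace ℝ (Fin n)}

/-- Each of the two dithers costs one factor e^c. The signs of their coefficients disappear because
the dominating Gaussians depend only on a² and b². -/
lemma IsSourceWithDithers.measureReal_dithered_notMem_le [Fintype V] [IsProbabilityMeasure P]
    (hT : IsGaussianMarkovTree T ν) (H : IsSourceWithDithers P ν L X d) {n : ℕ} (i : ℕ) {u v : V}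
    (huv : u ≠ v) (a b : ℝ) {s t c : ℝ} (hs : 0 ≤ s) (ht : 0 ≤ t)
    (hu : ProbabilityTheory.cond volume (L n u).voronoi
      ≤ ENNReal.ofReal (Real.exp c) • whiteGaussian n s)
    (hv : ProbabilityTheory.cond volume (L n v).voronoi
      ≤ ENNReal.ofReal (Real.exp c) • whiteGaussian n t)
    {A : Set (EuclideanSpace ℝ (Fin n))} (hA : MeasurableSet A) :
    P.real {ω | a • dithered (L n u) (block (X u) n i ω) (d n u i ω)
        + b • dithered (L n v) (block (X v) n i ω) (d n v i ω) ∉ A}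
      ≤ Real.exp (2 * c) * (whiteGaussian n
        (a ^ 2 + b ^ 2 + 2 * a * b * corr ν u v + (a ^ 2 * s + b ^ 2 * t))).real Aᶜ := by
  have hlaw := H.hasLaw_dithered hT n i huv a b
  have hle := conv_conv_le (hT.variance_nonneg u v a b) hs ht ENNReal.ofReal_ne_top hu hv (-a) (-b)
  rw [neg_sq, neg_sq] at hle
  have hm := hlaw.measure_eq (p := fun x => x ∉ A) hA.compl
  have h := hle Aᶜ
  rw [Measure.smul_apply, smul_eq_mul, ← ENNReal.ofReal_mul (Real.exp_pos _).le, ← Real.exp_add,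
    ← two_mul] at h
  rw [measureReal_def, hm]
  refine (ENNReal.toReal_mono (ENNReal.mul_ne_top ENNReal.ofReal_ne_top (measure_ne_top _ _))
    h).trans_eq ?_
  rw [ENNReal.toReal_mul, ENNReal.toReal_ofReal (Real.exp_pos _).le, measureReal_def]

end Error

/-- Decoding succeeds if neither quantizer overloads and the estimation error lies in the Voronoi
region of the coarse lattice. -/
lemma estimate_eq {n : ℕ} {L L1 L2 M M2 : EucLattice n} {ρ : ℝ}
    {x d x' d' : EuclideanSpace ℝ (Fin n)}
    (hu : dithered M x' d' ∈ M2.strictVoronoi) (hv : dithered L x d ∈ L2.strictVoronoi)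
    (huv : ρ • dithered M x' d' + (-1 : ℝ) • dithered L x d ∈ L1.strictVoronoi) :
    estimate L1 ρ (quantized M M2 x' d') (L1.mod (quantized L L2 x d)) = quantized L L2 x d := by
  have h1 : quantized M M2 x' d' = dithered M x' d' := by
    change dithered M x' d' - M2.Q (dithered M x' d') = _
    rw [M2.Q_of_mem_strictVoronoi hu, sub_zero]
  have h2 : quantized L L2 x d = dithered L x d := by
    change dithered L x d - L2.Q (dithered L x d) = _
    rw [L2.Q_of_mem_strictVoronoi hv, sub_zero]
  rw [h1, h2, estimate, EucLattice.mod]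
  -- Since w = y_v − Q(y_v), the quantizer input is (ρy_u − y_v) + Q(y_v), which rounds to Q(y_v).
  have h3 := L1.Q_add_of_mem_strictVoronoi huv (L1.Q_mem (dithered L x d))
  rw [show ρ • dithered M x' d' - (dithered L x d - L1.Q (dithered L x d))
    = ρ • dithered M x' d' + (-1 : ℝ) • dithered L x d + L1.Q (dithered L x d) by
      rw [neg_one_smul]; abel, h3, sub_add_cancel]

/-- The slack 1 + δ is split in two: 1 + η pays for replacing dithers by Gaussians, 1 + δ' keeps μ
above 2πe. -/
lemma le_div_of_mul_lt {q A W B δ δ' η : ℝ} (hA : 0 ≤ A) (hδ' : 0 < δ')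
    (hη : (1 + η) * (1 + δ') ≤ 1 + δ) (hq : q ≤ (1 + η) * A) (hW : A * (1 + δ) < W / B) :
    q ≤ W / (B * (1 + δ')) := by
  rw [← div_div, le_div_iff₀ (by linarith)]
  calc q * (1 + δ') ≤ (1 + η) * A * (1 + δ') := by gcongr
    _ = A * ((1 + η) * (1 + δ')) := by ring
    _ ≤ A * (1 + δ) := by gcongr
    _ ≤ W / B := hW.le

end LatticeKey

/-! ### Choice of constants and the union bound -/

theorem proposition1 :
    -- the exponent: a function of `δ`, positive for every `δ > 0`
    ∃ E : ℝ → ℝ, (∀ δ : ℝ, 0 < δ → 0 < E δ) ∧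
      ∀ {V : Type*} [Fintype V] (T : SimpleGraph V) (ν : Measure (V → ℝ))
        (_ : IsGaussianMarkovTree T ν)
        -- the nested lattices `Λ_v⁽²⁾ ⊆ Λ_v⁽¹⁾ ⊆ Λ_v` of every terminal, in every dimension
        (L L1 L2 : ∀ n : ℕ, V → EucLattice n)
        (_ : ∀ n v, (L2 n v).pts ≤ (L1 n v).pts) (_ : ∀ n v, (L1 n v).pts ≤ (L n v).pts)
        -- goodness
        (_ : ∀ v, GoodForCovering (fun n => L n v))
        (_ : ∀ v, GoodForAWGN (fun n => L1 n v))
        (_ : ∀ v, GoodForAWGN (fun n => L2 n v))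
        -- source and dithers
        {Ω : Type*} [MeasurableSpace Ω] (P : Measure Ω) [IsProbabilityMeasure P]
        (X : V → ℕ → Ω → ℝ) (d : ∀ n : ℕ, V → ℕ → Ω → EuclideanSpace ℝ (Fin n))
        (_ : IsSourceWithDithers P ν L X d)
        (u v : V) (_ : T.Adj u v) (δ : ℝ) (_ : 0 < δ),
        ∀ᶠ n : ℕ in atTop,
          -- the volume conditions
          (∀ u' : V, T.Adj u' v →
            (1 - corr ν u' v ^ 2 + (L n v).sigmaSq + corr ν u' v ^ 2 * (L n u').sigmaSq) * (1 + δ)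
              < (L1 n v).vol ^ (2 / (n : ℝ)) / (2 * Real.pi * Real.exp 1)) →
          (1 + (L n v).sigmaSq) * (1 + δ)
              < (L2 n v).vol ^ (2 / (n : ℝ)) / (2 * Real.pi * Real.exp 1) →
          (1 + (L n u).sigmaSq) * (1 + δ)
              < (L2 n u).vol ^ (2 / (n : ℝ)) / (2 * Real.pi * Real.exp 1) →
          ∀ i : ℕ,
            let y : V → Ω → EuclideanSpace ℝ (Fin n) := fun s ω =>
              quantized (L n s) (L2 n s) (block (X s) n i ω) (d n s i ω)
            let w : Ω → EuclideanSpace ℝ (Fin n) := fun ω => (L1 n v).mod (y v ω)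
            let yHat : Ω → EuclideanSpace ℝ (Fin n) := fun ω =>
              estimate (L1 n v) (corr ν u v) (y u ω) (w ω)
            P.real {ω | yHat ω ≠ y v ω} ≤ Real.exp (-(n * E δ)) := by
  -- Capping at 1 keeps μ in the first branch of E_U; half of E_U(μ) is given up to absorb all
  -- losses.
  refine ⟨fun δ => poltyrevExponent (2 * Real.pi * Real.exp 1 * (1 + min δ 1 / 2)) / 2,
    fun δ hδ => half_pos (poltyrevExponent_pos (by positivity)
      (by linarith [min_le_right δ 1])), ?_⟩
  intro V _ T ν hT L L1 L2 _ _ hcov hawgn1 hawgn2 Ω _ P _ X d H u v huv δ hδ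
  set δ' := min δ 1 / 2 with hδ'def
  have hδ' : 0 < δ' := by positivity
  have hδ'1 : δ' ≤ 1 / 2 := by linarith [min_le_right δ 1]
  have hδ'δ : 2 * δ' ≤ δ := by linarith [min_le_left δ 1]
  set B : ℝ := 2 * Real.pi * Real.exp 1 with hB
  have hBpos : 0 < B := by positivity
  set E₀ := poltyrevExponent (B * (1 + δ')) with hE₀
  have hE₀pos : 0 < E₀ := poltyrevExponent_pos hδ' (by linarith)
  -- The first bound serves the variance budget `hbudget`, the second the exponent budget `hexp`.
  set η := min (δ' / 2) (E₀ / 8) with hηdef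
  have hη : 0 < η := by positivity
  have hη1 : η ≤ δ' / 2 := min_le_left _ _
  have hη2 : η ≤ E₀ / 8 := min_le_right _ _
  have hbudget : (1 + η) * (1 + δ') ≤ 1 + δ := by nlinarith
  have hμ : B ≤ B * (1 + δ') := by nlinarith
  have hε : 0 < E₀ / 8 := by positivity
  have hlim : Tendsto (fun n : ℕ => Real.exp (n * (E₀ / 8))) atTop atTop :=
    Real.tendsto_exp_atTop.comp (tendsto_natCast_atTop_atTop.atTop_mul_const hε)
  filter_upwards [(hcov u).eventually_dominated hη, (hcov v).eventually_dominated hη,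
    (hawgn1 v).eventually_le hμ hε, (hawgn2 v).eventually_le hμ hε,
    (hawgn2 u).eventually_le hμ hε, hlim.eventually_ge_atTop 3]
    with n ⟨s, hs, hsσ, hsdom⟩ ⟨t, ht, htσ, htdom⟩ hE1 hE2v hE2u h3 hvol1 hvol2v hvol2u i
  intro y w yHat
  have hσu : 0 < (L n u).sigmaSq := pos_of_mul_pos_right (hs.trans_le hsσ) (by linarith)
  have hσv : 0 < (L n v).sigmaSq := pos_of_mul_pos_right (ht.trans_le htσ) (by linarith)
  set ρ := corr ν u v with hρ
  have hρ1 : 0 ≤ 1 - ρ ^ 2 := by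
    have := hT.variance_nonneg u v ρ (-1)
    rw [← hρ] at this
    linarith
  let S : ℝ → ℝ → Ω → EuclideanSpace ℝ (Fin n) := fun a b ω =>
    a • dithered (L n u) (block (X u) n i ω) (d n u i ω)
      + b • dithered (L n v) (block (X v) n i ω) (d n v i ω)
  -- The losses are at most E₀/4 from the two dithers and E₀/8 from o(1). The exponent 5E₀/8 that
  -- remains exceeds E₀/2 by E₀/8, which beats the factor 3 of the union bound.
  have hexp : Real.exp (2 * (n * η)) * Real.exp (-(n * (E₀ - E₀ / 8)))
      ≤ Real.exp (-(n * (E₀ / 2))) / Real.exp (n * (E₀ / 8)) := by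
    rw [← Real.exp_add, ← Real.exp_sub, Real.exp_le_exp]
    have := mul_le_mul_of_nonneg_left hη2 (Nat.cast_nonneg (α := ℝ) n)
    linarith
  have bound : ∀ (a b : ℝ) (M : EucLattice n) (q A : ℝ),
      q = a ^ 2 + b ^ 2 + 2 * a * b * ρ + (a ^ 2 * s + b ^ 2 * t) → 0 < q → 0 ≤ A →
      q ≤ (1 + η) * A → A * (1 + δ) < M.vol ^ (2 / (n : ℝ)) / B →
      (∀ s : ℝ, 0 < s → s ≤ M.vol ^ (2 / (n : ℝ)) / (B * (1 + δ')) →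
        (whiteGaussian n s).real M.strictVoronoiᶜ ≤ Real.exp (-(n * (E₀ - E₀ / 8)))) →
      P.real {ω | S a b ω ∉ M.strictVoronoi}
        ≤ Real.exp (-(n * (E₀ / 2))) / Real.exp (n * (E₀ / 8)) := by
    intro a b M q A hq hq0 hA hqA hvol hM
    refine (H.measureReal_dithered_notMem_le hT i huv.ne a b hs.le ht.le hsdom htdom
      M.measurableSet_strictVoronoi).trans (le_trans ?_ hexp)
    rw [← hρ, ← hq]
    gcongr
    exact hM q hq0 (le_div_of_mul_lt hA hδ' hbudget hqA hvol)
  have bu := bound 1 0 (L2 n u) (1 + s) (1 + (L n u).sigmaSq) (by ring) (by linarith)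
    (by linarith) (by linarith) hvol2u hE2u
  have bv := bound 0 1 (L2 n v) (1 + t) (1 + (L n v).sigmaSq) (by ring) (by linarith)
    (by linarith) (by linarith) hvol2v hE2v
  have hρs : ρ ^ 2 * s ≤ ρ ^ 2 * ((1 + η) * (L n u).sigmaSq) := by gcongr
  -- The source part ρX_u − X_v has variance 1 − ρ², so the total is the quantity in the first
  -- volume condition with s, t in place of the second moments.
  have buv := bound ρ (-1) (L1 n v) (1 - ρ ^ 2 + (ρ ^ 2 * s + t))
    (1 - ρ ^ 2 + (L n v).sigmaSq + ρ ^ 2 * (L n u).sigmaSq) (by ring) (by positivity)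
    (by positivity) (by nlinarith [mul_nonneg hη.le hρ1]) (hvol1 u huv) hE1
  have hsub : {ω | yHat ω ≠ y v ω} ⊆ {ω | S 1 0 ω ∉ (L2 n u).strictVoronoi} ∪
      ({ω | S 0 1 ω ∉ (L2 n v).strictVoronoi} ∪ {ω | S ρ (-1) ω ∉ (L1 n v).strictVoronoi}) := by
    intro ω hω
    by_contra hcon
    simp only [Set.mem_union, Set.mem_ofPred_eq, not_or, not_not, S, one_smul, zero_smul,
      add_zero, zero_add] at hcon
    exact hω (estimate_eq hcon.1 hcon.2.1 hcon.2.2)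
  have hunion := (measureReal_mono hsub (measure_ne_top P _)).trans ((measureReal_union_le _ _).trans
    (add_le_add bu ((measureReal_union_le _ _).trans (add_le_add bv buv))))
  refine hunion.trans ?_
  change _ ≤ Real.exp (-(n * (E₀ / 2)))
  have hpos := Real.exp_pos (n * (E₀ / 8))
  rw [← add_div, ← add_div, div_le_iff₀ hpos]
  nlinarith [Real.exp_pos (-(n * (E₀ / 2)))]
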